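/- Let $K$ be a real quadratic field with ring of integers $\mathcal{O}_K$, regarded as a subfield of $\mathbb{R}$ through a fixed embedding. Let $V_K = K\otimes_{\mathbb{Q}}\mathbb{R}$, which contains $\mathcal{O}_K$ as a lattice, let $\mathbb{T}_K = V_K/\mathcal{O}_K$, and let $\mathbf{N}\colon V_K\to\mathbb{R}_{\ge 0}$ be the extension of the absolute norm $a\mapsto|\mathrm{Nm}_{K/\mathbb{Q}}(a)|$; that is, $\mathbf{N}(s,u)=|su|$ under the isomorphism $V_K\cong\mathbb{R}\times\mathbb{R}$ given by the two real embeddings of $K$. For $P\in V_K$ put $$M(P)=\inf_{Q\in\mathcal{O}_K}\mathbf{N}(P-Q).$$ This depends only on the class of $P$ in $\mathbb{T}_K$, and so defines a function $M\colon\mathbb{T}_K\to\mathbb{R}$. Let $\mathrm{ES}(K)=M(\mathbb{T}_K)\subseteq\mathbb{R}$ be the Euclidean spectrum of $K$. Call a point of $\mathbb{T}_K$ a $K$-point if it is the class of a point of $V_K$ whose coordinates with respect to a $\mathbb{Z}$-basis of $\mathcal{O}_K$ (which is an $\mathbb{R}$-basis of $V_K$) lie in $K$. Then: (1) $\mathrm{ES}(K)\cap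 K$ is dense in $\mathrm{ES}(K)$; (2) for every isolated point $t$ of $\mathrm{ES}(K)$ there is a $K$-point $P\in\mathbb{T}_K$ with $M(P)=t$, and $t\in K$. -/

import Mathlib

open NumberField NumberField.mixedEmbedding

noncomputable section

namespace EuclideanSpectrum

variable (K : Type*) [Field K] [NumberField K]

/-- The torus `V_K / 𝓞 K`, where `V_K = K ⊗ ℝ` is Mathlib's mixed space of `K` (for a real
quadratic field: the product of two copies of `ℝ`, one for each real embedding), and `𝓞 K` is
embedded in it as a lattice. -/
abbrev Torus : Type _ := mixedSpace K ⧸ (mixedEmbedding.integerLattice K).toAddSubgroup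

variable {K}

/-- The function `M(P) = inf_{Q ∈ 𝓞 K} N(P - Q)` on `V_K`, with `N` the absolute norm
(for a real quadratic field: the absolute value of the product of the two coordinates). -/
def minNorm (P : mixedSpace K) : ℝ :=
  ⨅ q : 𝓞 K, mixedEmbedding.norm (P - mixedEmbedding K (q : K))

theorem minNorm_sub_integer (P : mixedSpace K) (a : 𝓞 K) :
    minNorm (P - mixedEmbedding K (a : K)) = minNorm P := by
  unfold minNorm
  refine (Equiv.addLeft a).iInf_congr fun q => ?_
  simp [sub_sub]

/-- The function induced by `M` on the torus. -/
def torusMin : Torus K → ℝ :=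
  Quotient.lift minNorm (by
    intro P Q h
    have h' : -P + Q ∈ (mixedEmbedding.integerLattice K).toAddSubgroup := QuotientAddGroup.leftRel_apply.mp h
    obtain ⟨a, ha⟩ : ∃ a : 𝓞 K, mixedEmbedding K (a : K) = -P + Q := by
      simpa [mixedEmbedding.integerLattice] using h'
    have hP : P = Q - mixedEmbedding K (a : K) := by rw [ha]; abel
    rw [hP, minNorm_sub_integer])

variable (K) in
/-- The Euclidean spectrum of `K`. -/
def spectrum : Set ℝ := Set.range (torusMin (K := K))

/-- The `K`-points of the torus, for `K` regarded as a subfield of `ℝ` through `σ`: the classes of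
the points of `V_K` whose coordinates with respect to a `ℤ`-basis of `𝓞 K` lie in `K`. -/
def IsKPoint (σ : K →+* ℝ) (P : Torus K) : Prop :=
  ∃ x : mixedSpace K, (QuotientAddGroup.mk x : Torus K) = P ∧
    ∀ i, (latticeBasis K).repr x i ∈ Set.range σ

/-- `t` is an isolated point of the set `S` of real numbers. -/
def IsIsolatedPoint (S : Set ℝ) (t : ℝ) : Prop :=
  t ∈ S ∧ ∃ δ > 0, ∀ t' ∈ S, |t' - t| < δ → t' = t

end EuclideanSpectrum

end

namespace EuclideanSpectrum

variable {K : Type*} [Field K]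

/-! A unit `u` with embeddings `l > 1` and `m = 1/l` acts hyperbolically on the torus and preserves
`M`. Any point `(x, y)` is approximated in `M` by a point `(s, t)` over the field, found by
shadowing (`exists_shadow`): an almost closed piece of the forward orbit fixes `s`, one of the
backward orbit fixes `t`, and the whole orbit of `(s, t)` stays near that of `(x, y)`. Hence `M` can
hardly drop, and by upper semicontinuity it can hardly rise (`exists_pairMin_near`). That `M(s, t)`
lies in `K` is separate (`pairMin_mem_fieldRange`): after scaling by powers of `u`, bounded values
of the norm form come from finitely many elements of `K`, up to an error that decays like `m ^ n`.
They fill a closed subset of `K`, which contains the infimum. -/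

/-- The infimum of `|(x - f q) (y - g q)|` over the algebraic integers `q`. -/
noncomputable def pairMin (f g : K →+* ℝ) (x y : ℝ) : ℝ :=
  ⨅ q : 𝓞 K, |(x - f q) * (y - g q)|

/-- The properties of the two real embeddings of a real quadratic field on which the argument
depends. -/
structure IsRealPair (f g : K →+* ℝ) : Prop where
  fieldRange_eq : f.fieldRange = g.fieldRange
  finite_bounded : ∀ B : ℝ, {q : 𝓞 K | |f q| ≤ B ∧ |g q| ≤ B}.Finite
  exists_near : ∃ B : ℝ, ∀ x y : ℝ, ∃ q : 𝓞 K, |x - f q| ≤ B ∧ |y - g q| ≤ B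
  exists_unit : ∃ u : (𝓞 K)ˣ, 1 < f (u : 𝓞 K) ∧ f (u : 𝓞 K) * g (u : 𝓞 K) = 1

theorem bddBelow_pair (f g : K →+* ℝ) (x y : ℝ) :
    BddBelow (Set.range fun q : 𝓞 K => |(x - f q) * (y - g q)|) :=
  ⟨0, by rintro _ ⟨q, rfl⟩; positivity⟩

theorem pairMin_le (f g : K →+* ℝ) (x y : ℝ) (q : 𝓞 K) :
    pairMin f g x y ≤ |(x - f q) * (y - g q)| :=
  ciInf_le (bddBelow_pair f g x y) q

theorem pairMin_mem_closure (f g : K →+* ℝ) (x y : ℝ) :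
    pairMin f g x y ∈ closure (Set.range fun q : 𝓞 K => |(x - f q) * (y - g q)|) :=
  csInf_mem_closure (Set.range_nonempty _) (bddBelow_pair f g x y)

/-! ### Hyperbolic action of a unit -/

/-- A pair with bounded product is brought into a bounded region by the hyperbolic action. -/
theorem exists_pow_scale {l m : ℝ} (hl : 1 < l) (hlm : l * m = 1) {T : ℝ} (hT : 1 ≤ T)
    {z w : ℝ} (h : |z * w| ≤ T) :
    ∃ n : ℕ, (|l ^ n * z| ≤ l * T ∧ |m ^ n * w| ≤ l * T) ∨
      (|m ^ n * z| ≤ l * T ∧ |l ^ n * w| ≤ l * T) := by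
  have hl0 : 0 < l := by linarith
  have hm0 : 0 < m := by
    by_contra! hm
    nlinarith
  have hm : m = l⁻¹ := eq_inv_of_mul_eq_one_right hlm
  have hm1 : m < 1 := by rw [hm]; exact inv_lt_one_of_one_lt₀ hl
  have hlT : 1 ≤ l * T := by nlinarith
  have hTl : T ≤ l * T := by nlinarith
  have hpow : ∀ n : ℕ, l ^ n * m ^ n = 1 := fun n => by rw [← mul_pow, hlm, one_pow]
  have small : ∀ a : ℝ, ∃ n : ℕ, |m ^ n * a| ≤ 1 := by
    intro a
    have h1 : Filter.Tendsto (fun n : ℕ => m ^ n * a) Filter.atTop (nhds (0 * a)) :=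
      (tendsto_pow_atTop_nhds_zero_of_lt_one hm0.le hm1).mul_const a
    rw [zero_mul] at h1
    obtain ⟨n, hn⟩ := (h1.abs.eventually_lt_const (u := 1) (by norm_num)).exists
    exact ⟨n, hn.le⟩
  -- the case of a large second coordinate, in symmetric form
  have key : ∀ a b : ℝ, |a * b| ≤ T → 1 ≤ |b| →
      ∃ n : ℕ, |l ^ n * a| ≤ l * T ∧ |m ^ n * b| ≤ l * T := by
    intro a b hab hb
    -- With `l ^ n ≤ |b| < l ^ (n + 1)`, the first factor grows to at most `|a * b|`.
    obtain ⟨n, hn1, hn2⟩ := exists_nat_pow_near hb hl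
    refine ⟨n, ?_, ?_⟩
    · rw [abs_mul, abs_of_pos (pow_pos hl0 n)]
      refine le_trans ?_ (hab.trans hTl)
      rw [abs_mul, mul_comm]
      gcongr
    · rw [abs_mul, abs_of_pos (pow_pos hm0 n)]
      calc m ^ n * |b| ≤ m ^ n * l ^ (n + 1) := by gcongr
        _ = l * (l ^ n * m ^ n) := by ring
        _ ≤ l * T := by rw [hpow]; gcongr
  by_cases hw : 1 ≤ |w|
  · obtain ⟨n, hn⟩ := key z w h hw
    exact ⟨n, .inl hn⟩
  by_cases hz : 1 ≤ |z|
  · obtain ⟨n, hn⟩ := key w z (by rwa [mul_comm]) hz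
    exact ⟨n, .inr hn.symm⟩
  · refine ⟨0, .inl ?_⟩
    simp only [pow_zero, one_mul]
    constructor <;> linarith

namespace IsRealPair

variable {f g : K →+* ℝ}

/-- Inverting `u` swaps its two embeddings, so the backward orbit is a forward orbit for the pair
`(g, f)`. -/
theorem inv_unit_eq {u : (𝓞 K)ˣ} (hu' : f (u : 𝓞 K) * g (u : 𝓞 K) = 1) :
    g ((u⁻¹ : (𝓞 K)ˣ) : 𝓞 K) = f (u : 𝓞 K) ∧ f ((u⁻¹ : (𝓞 K)ˣ) : 𝓞 K) = g (u : 𝓞 K) := by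
  have hf : f (u : 𝓞 K) * f ((u⁻¹ : (𝓞 K)ˣ) : 𝓞 K) = 1 := by
    rw [← map_mul, ← map_mul, Units.mul_inv, map_one, map_one]
  have hg : g (u : 𝓞 K) * g ((u⁻¹ : (𝓞 K)ˣ) : 𝓞 K) = 1 := by
    rw [← map_mul, ← map_mul, Units.mul_inv, map_one, map_one]
  constructor
  · apply mul_left_cancel₀ (right_ne_zero_of_mul_eq_one hu')
    rw [hg, mul_comm, hu']
  · apply mul_left_cancel₀ (left_ne_zero_of_mul_eq_one hu')
    rw [hf, hu']

theorem symm (h : IsRealPair f g) : IsRealPair g f where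
  fieldRange_eq := h.fieldRange_eq.symm
  finite_bounded B := by simpa only [and_comm] using h.finite_bounded B
  exists_near := by
    obtain ⟨B, hB⟩ := h.exists_near
    exact ⟨B, fun x y => (hB y x).imp fun q hq => hq.symm⟩
  exists_unit := by
    obtain ⟨u, hu, hu'⟩ := h.exists_unit
    obtain ⟨hg, hf⟩ := inv_unit_eq hu'
    exact ⟨u⁻¹, by rwa [hg], by rwa [hg, hf]⟩

/-! ### Minima at points over the field -/

/-- Finitely many elements of `K` have a given denominator and bounded embeddings. -/
theorem finite_denominator (h : IsRealPair f g) {d : 𝓞 K} (hd : d ≠ 0) (B : ℝ) :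
    {c : K | (∃ r : 𝓞 K, (d : K) * c = r) ∧ |f c| ≤ B ∧ |g c| ≤ B}.Finite := by
  have hdK : (d : K) ≠ 0 := by simpa using hd
  set D := max |f d| |g d| with hD
  refine ((h.finite_bounded (D * B)).image fun r : 𝓞 K => (r : K) / (d : K)).subset ?_
  rintro c ⟨⟨r, hr⟩, hf, hg⟩
  refine ⟨r, ⟨?_, ?_⟩, ?_⟩
  · rw [← hr, map_mul, abs_mul]
    exact mul_le_mul (le_max_left _ _) hf (abs_nonneg _)
      ((abs_nonneg _).trans (le_max_left _ _))
  · rw [← hr, map_mul, abs_mul]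
    exact mul_le_mul (le_max_right _ _) hg (abs_nonneg _)
      ((abs_nonneg _).trans (le_max_left _ _))
  · simp only [← hr]
    field_simp

/-- Along the forward orbit, the bounded values of the norm form lie in a closed set of elements of
the field. -/
theorem exists_closed_values [NumberField K] (h : IsRealPair f g) {u : (𝓞 K)ˣ} (hu : 1 < f (u : 𝓞 K))
    (hu' : f (u : 𝓞 K) * g (u : 𝓞 K) = 1) (a : K) {y : ℝ} (hy : y ∈ f.fieldRange) (B : ℝ) :
    ∃ C : Set ℝ, IsClosed C ∧ C ⊆ f.fieldRange ∧ ∀ (q : 𝓞 K) (n : ℕ),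
      |f (u : 𝓞 K) ^ n * (f a - f q)| ≤ B → |g (u : 𝓞 K) ^ n * (y - g q)| ≤ B →
        |(f a - f q) * (y - g q)| ∈ C := by
  obtain ⟨r, d, hd, ha⟩ : ∃ r d : 𝓞 K, d ≠ 0 ∧ a = (r : K) / d := by
    obtain ⟨r, d, hd, ha⟩ := IsFractionRing.div_surjective (A := 𝓞 K) a
    exact ⟨r, d, nonZeroDivisors.ne_zero hd, ha.symm⟩
  have hdK : (d : K) ≠ 0 := by simpa using hd
  set l := f (u : 𝓞 K) with hl
  set m := g (u : 𝓞 K) with hm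
  have hm0 : 0 < m := by
    by_contra! hm
    nlinarith
  have hm1 : m < 1 := by nlinarith
  have hpow : ∀ n : ℕ, l ^ n * m ^ n = 1 := fun n => by rw [← mul_pow, hu', one_pow]
  have hmF : m ∈ f.fieldRange := by rw [h.fieldRange_eq]; exact ⟨_, rfl⟩
  have hgF : ∀ c : K, g c ∈ f.fieldRange := fun c => by rw [h.fieldRange_eq]; exact ⟨_, rfl⟩
  set S := {c : K | (∃ r : 𝓞 K, (d : K) * c = r) ∧
    |f c| ≤ B + |g a - y| ∧ |g c| ≤ B + |g a - y|} with hS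
  have hSfin : S.Finite := h.finite_denominator hd _
  have hcomp : IsCompact (insert (0 : ℝ) (Set.range fun n : ℕ => m ^ n)) :=
    (tendsto_pow_atTop_nhds_zero_of_lt_one hm0.le hm1).isCompact_insert_range
  -- For `c = u ^ n * (a - q)` the value is the one at `s = m ^ n`. Adjoining `s = 0` supplies the
  -- limit `|f c * g c|`, which is still in the field.
  refine ⟨⋃ c ∈ S, (fun s : ℝ => |f c * (g c + s * (y - g a))|) ''
    (insert (0 : ℝ) (Set.range fun n : ℕ => m ^ n)), ?_, ?_, ?_⟩
  · exact hSfin.isClosed_biUnion fun c _ => (hcomp.image (by fun_prop)).isClosed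
  · simp only [Set.iUnion_subset_iff]
    rintro c - _ ⟨s, hs, rfl⟩
    have hsF : s ∈ f.fieldRange := by
      rcases hs with rfl | ⟨n, rfl⟩
      · exact zero_mem _
      · exact pow_mem hmF n
    have : f c * (g c + s * (y - g a)) ∈ f.fieldRange :=
      mul_mem ⟨_, rfl⟩ (add_mem (hgF c) (mul_mem hsF (sub_mem hy (hgF a))))
    rcases abs_choice (f c * (g c + s * (y - g a))) with h1 | h1 <;> simp only [h1]
    · exact this
    · exact neg_mem this
  · intro q n h1 h2
    set c : K := ((u : 𝓞 K) : K) ^ n * (a - q) with hc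
    have hfc : f c = l ^ n * (f a - f q) := by simp [hc, hl]
    have hgc : g c = m ^ n * (y - g q) + m ^ n * (g a - y) := by
      simp only [hc, hm, map_mul, map_pow, map_sub]; ring
    have hmn : m ^ n ≤ 1 := pow_le_one₀ hm0.le hm1.le
    simp only [Set.mem_iUnion]
    refine ⟨c, ⟨⟨u ^ n * (r - d * q), ?_⟩, ?_, ?_⟩, m ^ n, .inr ⟨n, rfl⟩, ?_⟩
    · simp only [hc, ha, map_mul, map_pow, map_sub]
      field_simp
    · rw [hfc]; exact h1.trans (by linarith [abs_nonneg (g a - y)])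
    · rw [hgc]
      refine (abs_add_le _ _).trans (add_le_add h2 ?_)
      rw [abs_mul, abs_of_pos (pow_pos hm0 n)]
      exact mul_le_of_le_one_left (abs_nonneg _) hmn
    · simp only [hfc, hgc]
      congr 1
      calc _ = (l ^ n * m ^ n) * ((f a - f q) * (y - g q)) := by ring
        _ = _ := by rw [hpow, one_mul]

/-- The minimum at a point with coordinates in the field lies in the field. -/
theorem pairMin_mem_fieldRange [NumberField K] (h : IsRealPair f g) {x y : ℝ} (hx : x ∈ f.fieldRange)
    (hy : y ∈ f.fieldRange) : pairMin f g x y ∈ f.fieldRange := by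
  obtain ⟨u, hu, hu'⟩ := h.exists_unit
  obtain ⟨hg, hf⟩ := inv_unit_eq hu'
  obtain ⟨a, rfl⟩ := hx
  obtain ⟨b, rfl⟩ : y ∈ g.fieldRange := by rwa [← h.fieldRange_eq]
  set T := |pairMin f g (f a) (g b)| + 1 with hT
  have hT1 : 1 ≤ T := by linarith [abs_nonneg (pairMin f g (f a) (g b))]
  have hlt : pairMin f g (f a) (g b) < T := by linarith [le_abs_self (pairMin f g (f a) (g b))]
  obtain ⟨C, hC, hCF, hCv⟩ := h.exists_closed_values hu hu' a hy (f (u : 𝓞 K) * T)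
  obtain ⟨C', hC', hCF', hCv'⟩ := h.symm.exists_closed_values (u := u⁻¹) (by rwa [hg])
    (by rwa [hf, hg]) b (y := f a) (by rw [← h.fieldRange_eq]; exact ⟨_, rfl⟩) (f (u : 𝓞 K) * T)
  have hmem : pairMin f g (f a) (g b) ∈ closure
      (Set.Iio T ∩ Set.range fun q : 𝓞 K => |(f a - f q) * (g b - g q)|) :=
    isOpen_Iio.inter_closure ⟨hlt, pairMin_mem_closure f g _ _⟩
  have hsub : Set.Iio T ∩ (Set.range fun q : 𝓞 K => |(f a - f q) * (g b - g q)|) ⊆ C ∪ C' := by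
    rintro _ ⟨hv, q, rfl⟩
    obtain ⟨n, ⟨h1, h2⟩ | ⟨h1, h2⟩⟩ := exists_pow_scale hu hu' hT1 (le_of_lt hv)
    · exact .inl (hCv q n h1 h2)
    · right
      simp only
      rw [mul_comm]
      exact hCv' q n (by rwa [hg]) (by rwa [hf])
  rcases closure_minimal hsub (hC.union hC') hmem with h1 | h1
  · exact hCF h1
  · rw [h.fieldRange_eq]; exact hCF' h1

/-! ### Shadowing by periodic orbits -/

/-- Near recurrence of the orbit of a point of the torus. -/
theorem exists_recurrence (h : IsRealPair f g) (X Y : ℕ → ℝ) {δ : ℝ} (hδ : 0 < δ) :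
    ∃ (i j : ℕ) (r : 𝓞 K), i < j ∧ |X j - X i - f r| ≤ δ ∧ |Y j - Y i - g r| ≤ δ := by
  obtain ⟨B, hB⟩ := h.exists_near
  choose q hq1 hq2 using fun n => hB (X n) (Y n)
  have hmem : ∀ n, ((X n - f (q n), Y n - g (q n)) : ℝ × ℝ) ∈ Metric.closedBall (0 : ℝ × ℝ) B := by
    intro n
    rw [mem_closedBall_zero_iff, Prod.norm_def]
    exact max_le (hq1 n) (hq2 n)
  obtain ⟨_, _, φ, hφ, hlim⟩ := (isCompact_closedBall (0 : ℝ × ℝ) B).tendsto_subseq hmem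
  obtain ⟨N, hN⟩ := Metric.cauchySeq_iff.mp hlim.cauchySeq δ hδ
  have hd := hN (N + 1) (by simp) N le_rfl
  rw [Prod.dist_eq, max_lt_iff, Real.dist_eq, Real.dist_eq] at hd
  refine ⟨φ N, φ (N + 1), q (φ (N + 1)) - q (φ N), hφ (Nat.lt_succ_self N), ?_, ?_⟩
  · refine le_trans (le_of_eq ?_) hd.1.le
    simp only [Function.comp, map_sub]
    congr 1; ring
  · refine le_trans (le_of_eq ?_) hd.2.le
    simp only [Function.comp, map_sub]
    congr 1; ring

/-- One-sided shadowing: moving the first coordinate slightly, the forward orbit of a point is made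
asymptotic to a periodic orbit while staying near the forward orbit of the original point. -/
theorem exists_shadow (h : IsRealPair f g) {u : (𝓞 K)ˣ} (hu : 1 < f (u : 𝓞 K))
    (hu' : f (u : 𝓞 K) * g (u : 𝓞 K) = 1) (x y : ℝ) {ε : ℝ} (hε : 0 < ε) :
    ∃ s ∈ f.fieldRange, |s - x| ≤ ε ∧ ∀ y', |y' - y| ≤ ε → ∀ n : ℕ, ∃ (j : ℕ) (q : 𝓞 K),
      |f (u : 𝓞 K) ^ n * s - f (u : 𝓞 K) ^ j * x - f q| ≤ ε ∧
      |g (u : 𝓞 K) ^ n * y' - g (u : 𝓞 K) ^ j * y - g q| ≤ ε := by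
  set l := f (u : 𝓞 K) with hl
  set m := g (u : 𝓞 K) with hm
  have hl0 : 0 < l := by linarith
  have hm0 : 0 < m := by
    by_contra! hm
    nlinarith
  have hm1 : m < 1 := by nlinarith
  -- Chosen so that `m * ε + δ = ε`: contraction absorbs the jump made at each return.
  set δ := (1 - m) * ε with hδ
  have hδ0 : 0 < δ := mul_pos (by linarith) hε
  obtain ⟨i, k, r, hik, hd, he⟩ :=
    h.exists_recurrence (fun n => l ^ n * x) (fun n => m ^ n * y) hδ0
  set d := l ^ k * x - l ^ i * x - f r with hd_def
  have hki : 0 < l ^ k - l ^ i := sub_pos.mpr (pow_lt_pow_right₀ hu hik)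
  -- the displacement of the first coordinate
  set v := -d / (l ^ k - l ^ i) with hv
  have hvd : l ^ k * v + d = l ^ i * v := by rw [hv]; field_simp; ring
  have hvk : ∀ j < k, |l ^ j * v| ≤ ε := by
    intro j hj
    rw [hv, abs_mul, abs_div, abs_neg, abs_of_pos hki, abs_of_pos (pow_pos hl0 j), ← mul_div_assoc,
      div_le_iff₀ hki]
    have h1 : l * l ^ j ≤ l ^ k := by rw [← pow_succ']; exact pow_le_pow_right₀ hu.le hj
    have h2 : l * l ^ i ≤ l ^ k := by rw [← pow_succ']; exact pow_le_pow_right₀ hu.le hik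
    have h3 : l ^ j ≤ m * l ^ k := by
      calc l ^ j = m * (l * l ^ j) := by rw [← mul_assoc, mul_comm m l, hu', one_mul]
        _ ≤ _ := by gcongr
    have h4 : l ^ i ≤ m * l ^ k := by
      calc l ^ i = m * (l * l ^ i) := by rw [← mul_assoc, mul_comm m l, hu', one_mul]
        _ ≤ _ := by gcongr
    have h5 : (1 - m) * l ^ k ≤ l ^ k - l ^ i := by linarith
    calc l ^ j * |d| ≤ l ^ k * ((1 - m) * ε) := by
          have : l ^ j ≤ l ^ k := pow_le_pow_right₀ hu.le hj.le
          gcongr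
      _ = ε * ((1 - m) * l ^ k) := by ring
      _ ≤ ε * (l ^ k - l ^ i) := by gcongr
  refine ⟨x + v, ?_, ?_, ?_⟩
  · have h1 : x + v = f r / (l ^ k - l ^ i) := by
      rw [hv, hd_def]; field_simp; ring
    rw [h1]
    have hlF : l ∈ f.fieldRange := ⟨_, rfl⟩
    exact div_mem ⟨_, rfl⟩ (sub_mem (pow_mem hlF _) (pow_mem hlF _))
  · simpa using hvk 0 (by omega)
  · intro y' hy' n
    -- The time `j` climbs to `k - 1` and then returns to `i`. Keeping the first coordinate exact
    -- prevents its error from being multiplied by `l`.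
    suffices hs : ∃ (j : ℕ) (q : 𝓞 K), j < k ∧ l ^ n * (x + v) = l ^ j * x + f q + l ^ j * v ∧
        |m ^ n * y' - m ^ j * y - g q| ≤ ε by
      obtain ⟨j, q, hj, h1, h2⟩ := hs
      refine ⟨j, q, ?_, h2⟩
      rw [h1]
      refine le_trans (le_of_eq ?_) (hvk j hj)
      congr 1; ring
    induction n with
    | zero => exact ⟨0, 0, by omega, by simp, by simpa using hy'⟩
    | succ n ih =>
      obtain ⟨j, q, hj, h1, h2⟩ := ih
      have hc : ((u * q : 𝓞 K) : K) = ((u : 𝓞 K) : K) * (q : K) := rfl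
      have h1' : l ^ (n + 1) * (x + v) =
          l ^ (j + 1) * x + f ((u * q : 𝓞 K) : K) + l ^ (j + 1) * v := by
        rw [pow_succ', mul_assoc, h1, hc, map_mul, ← hl]; ring
      have h2' : |m ^ (n + 1) * y' - m ^ (j + 1) * y - g ((u * q : 𝓞 K) : K)| ≤ m * ε := by
        have : m ^ (n + 1) * y' - m ^ (j + 1) * y - g ((u * q : 𝓞 K) : K) =
            m * (m ^ n * y' - m ^ j * y - g q) := by
          rw [hc, map_mul, ← hm]; ring
        rw [this, abs_mul, abs_of_pos hm0]
        gcongr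
      rcases (Nat.succ_le_of_lt hj).lt_or_eq with hlt | heq
      · exact ⟨j + 1, u * q, hlt, h1', h2'.trans (by nlinarith)⟩
      · rw [Nat.succ_eq_add_one] at heq
        rw [heq] at h1' h2'
        have hc' : ((u * q + r : 𝓞 K) : K) = ((u * q : 𝓞 K) : K) + (r : K) := rfl
        refine ⟨i, u * q + r, hik, ?_, ?_⟩
        · rw [h1', hc', map_add]
          linear_combination hvd - hd_def
        · have : m ^ (n + 1) * y' - m ^ i * y - g ((u * q + r : 𝓞 K) : K) =
              (m ^ (n + 1) * y' - m ^ k * y - g ((u * q : 𝓞 K) : K)) +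
                (m ^ k * y - m ^ i * y - g r) := by
            rw [hc', map_add]; ring
          rw [this]
          refine (abs_add_le _ _).trans ?_
          linarith

/-- A value of the norm form near the orbit of `(x, y)` is not much smaller than the minimum. -/
theorem pairMin_le_of_near {u : (𝓞 K)ˣ} (hu' : f (u : 𝓞 K) * g (u : 𝓞 K) = 1)
    {x y s t ε B : ℝ} (hε : 0 ≤ ε) {n j : ℕ} {p q : 𝓞 K}
    (h1 : |f (u : 𝓞 K) ^ n * s - f (u : 𝓞 K) ^ j * x - f p| ≤ ε)
    (h2 : |g (u : 𝓞 K) ^ n * t - g (u : 𝓞 K) ^ j * y - g p| ≤ ε)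
    (h3 : |f (u : 𝓞 K) ^ n * (s - f q)| ≤ B) (h4 : |g (u : 𝓞 K) ^ n * (t - g q)| ≤ B) :
    pairMin f g x y ≤ |(s - f q) * (t - g q)| + (2 * B * ε + ε ^ 2) := by
  obtain ⟨hg, hf⟩ := inv_unit_eq hu'
  set l := f (u : 𝓞 K) with hl
  set m := g (u : 𝓞 K) with hm
  have hpow : ∀ n : ℕ, l ^ n * m ^ n = 1 := fun n => by rw [← mul_pow, hu', one_pow]
  -- Chosen so that `u ^ j` carries `(x, y) - q'` to within `ε` of the image of `(s, t) - q` under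
  -- `u ^ n`.
  set q' : 𝓞 K := ((u⁻¹ : (𝓞 K)ˣ) : 𝓞 K) ^ j * (u ^ n * q - p) with hq'
  have e1 : l ^ j * (x - f q') = l ^ n * (s - f q) - (l ^ n * s - l ^ j * x - f p) := by
    simp only [hq', map_mul, map_pow, map_sub, hf, ← hl]
    linear_combination (-(l ^ n * f q - f p)) * hpow j
  have e2 : m ^ j * (y - g q') = m ^ n * (t - g q) - (m ^ n * t - m ^ j * y - g p) := by
    simp only [hq', map_mul, map_pow, map_sub, hg, ← hm]
    linear_combination (-(m ^ n * g q - g p)) * hpow j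
  set z := l ^ n * (s - f q)
  set w := m ^ n * (t - g q)
  set a := l ^ n * s - l ^ j * x - f p
  set b := m ^ n * t - m ^ j * y - g p
  have e3 : (x - f q') * (y - g q') = (z - a) * (w - b) := by
    rw [← e1, ← e2]
    linear_combination (-(x - f q') * (y - g q')) * hpow j
  have e4 : (s - f q) * (t - g q) = z * w := by
    linear_combination (-(s - f q) * (t - g q)) * hpow n
  refine (pairMin_le f g x y q').trans ?_
  rw [e3, e4]
  have hB : 0 ≤ B := (abs_nonneg _).trans h3
  calc |(z - a) * (w - b)| = |z * w + (-(z * b)) + (-(a * w)) + a * b| := by congr 1; ring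
    _ ≤ |z * w| + |z| * |b| + |a| * |w| + |a| * |b| := by
        refine (abs_add_le _ _).trans (add_le_add ((abs_add_le _ _).trans (add_le_add
          ((abs_add_le _ _).trans (add_le_add le_rfl ?_)) ?_)) ?_) <;> simp [abs_mul]
    _ ≤ |z * w| + B * ε + ε * B + ε * ε := by gcongr
    _ = _ := by ring

theorem pairMin_comm (f g : K →+* ℝ) (x y : ℝ) : pairMin g f y x = pairMin f g x y := by
  simp only [pairMin, mul_comm]

/-- Points with coordinates in the field approximate the minimum at every point. -/
theorem exists_pairMin_near (h : IsRealPair f g) (x y : ℝ) {η : ℝ} (hη : 0 < η) :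
    ∃ s ∈ f.fieldRange, ∃ t ∈ f.fieldRange, |pairMin f g s t - pairMin f g x y| < η := by
  obtain ⟨u, hu, hu'⟩ := h.exists_unit
  obtain ⟨hg, hf⟩ := inv_unit_eq hu'
  set M := pairMin f g x y with hM
  set T := |M| + 1 with hT
  have hT1 : 1 ≤ T := by linarith [abs_nonneg M]
  have hMT : M ≤ T := by linarith [le_abs_self M]
  set B := f (u : 𝓞 K) * T with hB
  have hB0 : 0 ≤ B := by positivity
  obtain ⟨q₀, hq₀⟩ : ∃ q : 𝓞 K, |(x - f q) * (y - g q)| < M + η :=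
    exists_lt_of_ciInf_lt (lt_add_of_pos_right M hη)
  have hc1 : ∀ᶠ p : ℝ × ℝ in nhds (x, y), |(p.1 - f q₀) * (p.2 - g q₀)| < M + η :=
    (Continuous.tendsto (by fun_prop) (x, y)).eventually (gt_mem_nhds hq₀)
  obtain ⟨ε₁, hε₁, hball⟩ := Metric.eventually_nhds_iff.mp hc1
  have hc2 : ∀ᶠ ε : ℝ in nhds 0, 2 * B * ε + ε ^ 2 < η := by
    refine (Continuous.tendsto (f := fun ε : ℝ => 2 * B * ε + ε ^ 2) (by fun_prop) 0).eventually
      (gt_mem_nhds ?_)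
    simpa using hη
  obtain ⟨ε₂, hε₂, hsmall⟩ := Metric.eventually_nhds_iff.mp hc2
  set ε := min ε₁ ε₂ / 2 with hε
  have hmin : 0 < min ε₁ ε₂ := lt_min hε₁ hε₂
  have hε0 : 0 < ε := by positivity
  have hεε₁ : ε < ε₁ := by linarith [min_le_left ε₁ ε₂]
  have hεε₂ : ε < ε₂ := by linarith [min_le_right ε₁ ε₂]
  have hεη : 2 * B * ε + ε ^ 2 < η := hsmall (by simpa [abs_of_pos hε0] using hεε₂)
  obtain ⟨s, hsF, hs, hs'⟩ := h.exists_shadow hu hu' x y hε0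
  -- Each shadowing bound allows any nearby contracted coordinate, so `s` and `t` can be chosen
  -- independently.
  obtain ⟨t, htF, ht, ht'⟩ := h.symm.exists_shadow (u := u⁻¹) (by rwa [hg]) (by rwa [hf, hg])
    y x hε0
  refine ⟨s, hsF, t, by rwa [h.fieldRange_eq], abs_sub_lt_iff.mpr ⟨?_, ?_⟩⟩
  · have := hball (y := (s, t)) (by
      rw [Prod.dist_eq, max_lt_iff, Real.dist_eq, Real.dist_eq]
      exact ⟨hs.trans_lt hεε₁, ht.trans_lt hεε₁⟩)
    linarith [pairMin_le f g s t q₀]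
  · have key : M - (2 * B * ε + ε ^ 2) ≤ pairMin f g s t := by
      refine le_ciInf fun q => ?_
      rcases le_total |(s - f q) * (t - g q)| T with hle | hle
      · obtain ⟨n, ⟨h1, h2⟩ | ⟨h1, h2⟩⟩ := exists_pow_scale hu hu' hT1 hle
        · obtain ⟨j, p, h3, h4⟩ := hs' t ht n
          linarith [pairMin_le_of_near hu' hε0.le h3 h4 h1 h2]
        · obtain ⟨j, p, h3, h4⟩ := ht' s hs n
          have h5 := pairMin_le_of_near (f := g) (g := f) (u := u⁻¹) (by rwa [hf, hg]) hε0.le h3 h4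
            (q := q) (B := B) (by rwa [hg]) (by rwa [hf])
          rw [pairMin_comm, mul_comm (t - g q)] at h5
          linarith
      · have : 0 ≤ 2 * B * ε + ε ^ 2 := by positivity
        linarith
    linarith

end IsRealPair

end EuclideanSpectrum

/-! ### Real places of a quadratic field -/

namespace EuclideanSpectrum

/-- A point of the mixed space with given coordinates at two real places. -/
theorem exists_coords {K : Type*} [Field K] {w₁ w₂ : {w : InfinitePlace K // w.IsReal}} (hne : w₁ ≠ w₂)
    (a b : ℝ) :
    ∃ x : mixedSpace K, x.1 w₁ = a ∧ x.1 w₂ = b := by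
  classical
  exact ⟨(fun w => if w = w₁ then a else b, 0), by simp, by simp [hne.symm]⟩

variable {K : Type*} [Field K] [NumberField K]

/-- A quadratic extension is normal, so each embedding factors through the other. -/
theorem fieldRange_eq_of_finrank_eq_two (hK : Module.finrank ℚ K = 2) (f g : K →+* ℝ) :
    f.fieldRange = g.fieldRange := by
  have : Algebra.IsQuadraticExtension ℚ K := { finrank_eq_two' := hK }
  have key : ∀ f g : K →+* ℝ, f.fieldRange ≤ g.fieldRange := by
    rintro f g _ ⟨x, rfl⟩
    let _ : Algebra K ℝ := g.toAlgebra
    exact ⟨f.toRatAlgHom.restrictNormal K x, f.toRatAlgHom.restrictNormal_commutes K x⟩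
  exact le_antisymm (key f g) (key g f)

/-- The two real places of a quadratic field with a real embedding. -/
theorem exists_real_places (hK : Module.finrank ℚ K = 2) (σ : K →+* ℝ) :
    ∃ w₁ w₂ : {w : InfinitePlace K // w.IsReal}, w₁ ≠ w₂ ∧
      ∀ w : InfinitePlace K, w = w₁ ∨ w = w₂ := by
  classical
  have hw : (InfinitePlace.mk (Complex.ofRealHom.comp σ)).IsReal := by
    refine ⟨_, ?_, rfl⟩
    rw [ComplexEmbedding.isReal_iff]
    ext x
    simp [ComplexEmbedding.conjugate]
  have h1 := InfinitePlace.card_add_two_mul_card_eq_rank K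
  have h2 : 0 < InfinitePlace.nrRealPlaces K := Fintype.card_pos_iff.mpr ⟨⟨_, hw⟩⟩
  have h3 : InfinitePlace.nrRealPlaces K = 2 := by omega
  have h4 : InfinitePlace.nrComplexPlaces K = 0 := by omega
  obtain ⟨w₁, w₂, hne, huniv⟩ := Finset.card_eq_two.mp (Finset.card_univ.trans h3)
  refine ⟨w₁, w₂, hne, fun w => ?_⟩
  have hr : w.IsReal := by
    by_contra hr
    exact (Fintype.card_eq_zero_iff.mp h4).false ⟨w, InfinitePlace.not_isReal_iff_isComplex.mp hr⟩
  have : (⟨w, hr⟩ : {w : InfinitePlace K // w.IsReal}) ∈ ({w₁, w₂} : Finset _) := by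
    rw [← huniv]; exact Finset.mem_univ _
  simpa [Subtype.ext_iff] using this

section Places

variable {w₁ w₂ : {w : InfinitePlace K // w.IsReal}}

theorem norm_eq_of_places (hne : w₁ ≠ w₂)
    (hw : ∀ w : InfinitePlace K, w = w₁ ∨ w = w₂) (x : mixedSpace K) :
    mixedEmbedding.norm x = |x.1 w₁ * x.1 w₂| := by
  classical
  have huniv : (Finset.univ : Finset (InfinitePlace K)) = {w₁.1, w₂.1} := by
    ext w; simpa using hw w
  rw [mixedEmbedding.norm_apply, huniv, Finset.prod_pair (by simpa [Subtype.ext_iff] using hne),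
    normAtPlace_apply_of_isReal w₁.2, normAtPlace_apply_of_isReal w₂.2]
  simp [InfinitePlace.mult_isReal, abs_mul]

theorem minNorm_eq_of_places (hne : w₁ ≠ w₂)
    (hw : ∀ w : InfinitePlace K, w = w₁ ∨ w = w₂) (x : mixedSpace K) :
    minNorm x = pairMin (InfinitePlace.embedding_of_isReal w₁.2)
      (InfinitePlace.embedding_of_isReal w₂.2) (x.1 w₁) (x.1 w₂) := by
  simp only [minNorm, pairMin, norm_eq_of_places hne hw, Prod.fst_sub, Pi.sub_apply,
    mixedEmbedding_apply_isReal]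

theorem isRealPair_of_places (hK : Module.finrank ℚ K = 2) (hne : w₁ ≠ w₂)
    (hw : ∀ w : InfinitePlace K, w = w₁ ∨ w = w₂) :
    IsRealPair (InfinitePlace.embedding_of_isReal w₁.2)
      (InfinitePlace.embedding_of_isReal w₂.2) where
  fieldRange_eq := fieldRange_eq_of_finrank_eq_two hK _ _
  finite_bounded B := by
    refine ((Embeddings.finite_of_norm_le K ℂ B).preimage
      (RingOfIntegers.coe_injective (K := K)).injOn).subset ?_
    rintro q ⟨h1, h2⟩
    refine ⟨q.isIntegral_coe, ?_⟩
    rw [← InfinitePlace.le_iff_le]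
    intro w
    rcases hw w with rfl | rfl
    · rwa [← InfinitePlace.norm_embedding_of_isReal w₁.2]
    · rwa [← InfinitePlace.norm_embedding_of_isReal w₂.2]
  exists_near := by
    classical
    refine ⟨∑ i, ‖latticeBasis K i‖, fun a b => ?_⟩
    obtain ⟨x, rfl, rfl⟩ := exists_coords hne a b
    obtain ⟨q, hq⟩ : ∃ q : 𝓞 K, mixedEmbedding K q = ZSpan.floor (latticeBasis K) x := by
      simpa [mixedEmbedding.integerLattice] using
        (mem_span_latticeBasis K).mp (ZSpan.floor (latticeBasis K) x).2
    refine ⟨q, ?_⟩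
    have hz : ‖x - mixedEmbedding K q‖ ≤ ∑ i, ‖latticeBasis K i‖ := by
      rw [hq]
      exact ZSpan.norm_fract_le (latticeBasis K) x
    have h1 : ∀ w, |x.1 w - InfinitePlace.embedding_of_isReal w.2 q| ≤
        ∑ i, ‖latticeBasis K i‖ := fun w =>
      ((norm_le_pi_norm (x - mixedEmbedding K q).1 w).trans (norm_fst_le _)).trans hz
    exact ⟨h1 w₁, h1 w₂⟩
  exists_unit := by
    obtain ⟨u, hu⟩ := Units.dirichletUnitTheorem.exists_unit K w₁.1
    have h2 := hu w₂ (by simpa [Subtype.ext_iff] using hne.symm)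
    have hprod := norm_eq_of_places hne hw (mixedEmbedding K (u : 𝓞 K))
    rw [norm_unit, mixedEmbedding_apply_isReal, mixedEmbedding_apply_isReal] at hprod
    rw [← InfinitePlace.norm_embedding_of_isReal w₂.2, Real.norm_eq_abs] at h2
    set a := InfinitePlace.embedding_of_isReal w₁.2 (u : 𝓞 K) with ha
    set b := InfinitePlace.embedding_of_isReal w₂.2 (u : 𝓞 K) with hb
    have hab : a ^ 2 * b ^ 2 = 1 := by rw [← mul_pow, ← sq_abs, ← hprod, one_pow]
    have hb0 : b ≠ 0 := by rintro h; simp [h] at hab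
    have hb1 : |b| < 1 := (Real.log_neg_iff (abs_pos.mpr hb0)).mp h2
    have hb2 : b ^ 2 < 1 := by rwa [sq_lt_one_iff_abs_lt_one]
    have hb3 : 0 < b ^ 2 := by positivity
    have ea : InfinitePlace.embedding_of_isReal w₁.2 ((u ^ 2 : (𝓞 K)ˣ) : 𝓞 K) = a ^ 2 := by
      simp [ha]
    have eb : InfinitePlace.embedding_of_isReal w₂.2 ((u ^ 2 : (𝓞 K)ˣ) : 𝓞 K) = b ^ 2 := by
      simp [hb]
    -- Squaring makes both embeddings positive and turns the product `±1` into `1`.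
    refine ⟨u ^ 2, ?_, ?_⟩
    · rw [ea]; nlinarith
    · rw [ea, eb, hab]

/-- A point with both coordinates in the image of `K` is a `K`-point. -/
theorem latticeBasis_repr_mem (hne : w₁ ≠ w₂) (hw : ∀ w : InfinitePlace K, w = w₁ ∨ w = w₂)
    {F : Subfield ℝ} (hF₁ : (InfinitePlace.embedding_of_isReal w₁.2).fieldRange ≤ F)
    (hF₂ : (InfinitePlace.embedding_of_isReal w₂.2).fieldRange ≤ F) {x : mixedSpace K}
    (h₁ : x.1 w₁ ∈ F) (h₂ : x.1 w₂ ∈ F) (i) : (latticeBasis K).repr x i ∈ F := by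
  set f := InfinitePlace.embedding_of_isReal w₁.2 with hf
  set g := InfinitePlace.embedding_of_isReal w₂.2 with hg
  have hfg : f ≠ g := by
    intro h
    apply hne
    ext1
    apply InfinitePlace.embedding_injective
    ext a
    rw [← InfinitePlace.embedding_of_isReal_apply w₁.2,
      ← InfinitePlace.embedding_of_isReal_apply w₂.2, ← hf, ← hg, h]
  obtain ⟨θ, hθ⟩ := DFunLike.ne_iff.mp hfg
  have hθ' : f θ - g θ ≠ 0 := sub_ne_zero.mpr hθ
  have hfF : f θ ∈ F := hF₁ ⟨θ, rfl⟩
  have hgF : g θ ∈ F := hF₂ ⟨θ, rfl⟩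
  -- Solve for `x` in the basis `1, θ`; lattice coordinates of elements of `K` are rational.
  set β := (x.1 w₁ - x.1 w₂) / (f θ - g θ) with hβ
  set α := x.1 w₁ - β * f θ with hα
  have hβF : β ∈ F := div_mem (sub_mem h₁ h₂) (sub_mem hfF hgF)
  have hαF : α ∈ F := sub_mem h₁ (mul_mem hβF hfF)
  have hβ' : β * (f θ - g θ) = x.1 w₁ - x.1 w₂ := div_mul_cancel₀ _ hθ'
  have hx : x = α • mixedEmbedding K 1 + β • mixedEmbedding K θ := by
    refine Prod.ext (funext fun w => ?_) (funext fun w => ?_)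
    · have : (α • mixedEmbedding K 1 + β • mixedEmbedding K θ).1 w =
          α + β * InfinitePlace.embedding_of_isReal w.2 θ := by
        simp [mixedEmbedding_apply_isReal]
      rw [this]
      rcases hw w with h | h
      · obtain rfl : w = w₁ := Subtype.ext h
        rw [hα]; ring
      · obtain rfl : w = w₂ := Subtype.ext h
        rw [hα]; linear_combination hβ'
    · exfalso
      refine InfinitePlace.not_isReal_iff_isComplex.mpr w.2 ?_
      rcases hw w with h | h <;> rw [h]
      exacts [w₁.2, w₂.2]
  rw [hx, map_add, map_smul, map_smul, Finsupp.add_apply, Finsupp.smul_apply, Finsupp.smul_apply,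
    latticeBasis_repr_apply, latticeBasis_repr_apply, smul_eq_mul, smul_eq_mul]
  exact add_mem (mul_mem hαF (SubfieldClass.ratCast_mem F _)) (mul_mem hβF (SubfieldClass.ratCast_mem F _))

end Places

/-- `K`-points whose minimum lies in `K` approximate the minimum at every point of the torus. -/
theorem exists_isKPoint_near (hK : Module.finrank ℚ K = 2) (σ : K →+* ℝ) (P : Torus K) {η : ℝ}
    (hη : 0 < η) : ∃ Q : Torus K, IsKPoint σ Q ∧ torusMin Q ∈ Set.range σ ∧
      |torusMin Q - torusMin P| < η := by
  obtain ⟨w₁, w₂, hne, hw⟩ := exists_real_places hK σ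
  have h := isRealPair_of_places hK hne hw
  have hF₁ := fieldRange_eq_of_finrank_eq_two hK (InfinitePlace.embedding_of_isReal w₁.2) σ
  have hF₂ := fieldRange_eq_of_finrank_eq_two hK (InfinitePlace.embedding_of_isReal w₂.2) σ
  obtain ⟨x, rfl⟩ := QuotientAddGroup.mk_surjective P
  obtain ⟨s, hs, t, ht, hst⟩ := h.exists_pairMin_near (x.1 w₁) (x.1 w₂) hη
  obtain ⟨y, rfl, rfl⟩ := exists_coords hne s t
  have hy : torusMin (QuotientAddGroup.mk y : Torus K) = _ := minNorm_eq_of_places hne hw y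
  have hx : torusMin (QuotientAddGroup.mk x : Torus K) = _ := minNorm_eq_of_places hne hw x
  refine ⟨QuotientAddGroup.mk y, ⟨y, rfl, fun i => ?_⟩, ?_, by rwa [hx, hy]⟩
  · rw [hF₁] at hs ht
    exact latticeBasis_repr_mem hne hw hF₁.le hF₂.le hs ht i
  · rw [hy, ← RingHom.coe_fieldRange, ← hF₁]
    exact h.pairMin_mem_fieldRange hs ht

end EuclideanSpectrum

theorem theorem2 {K : Type*} [Field K] [NumberField K] (hK : Module.finrank ℚ K = 2)
    (σ : K →+* ℝ) :
    EuclideanSpectrum.spectrum K ⊆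
        closure (EuclideanSpectrum.spectrum K ∩ Set.range σ) ∧
      ∀ t : ℝ, EuclideanSpectrum.IsIsolatedPoint (EuclideanSpectrum.spectrum K) t →
        (∃ P : EuclideanSpectrum.Torus K,
          EuclideanSpectrum.IsKPoint σ P ∧ EuclideanSpectrum.torusMin P = t) ∧
        t ∈ Set.range σ := by
  constructor
  · rintro _ ⟨P, rfl⟩
    rw [Metric.mem_closure_iff]
    intro η hη
    obtain ⟨Q, -, hQ, hPQ⟩ := EuclideanSpectrum.exists_isKPoint_near hK σ P hη
    exact ⟨_, ⟨⟨Q, rfl⟩, hQ⟩, by rwa [dist_comm, Real.dist_eq]⟩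
  · rintro _ ⟨⟨P, rfl⟩, δ, hδ, hiso⟩
    obtain ⟨Q, hKQ, hQ, hPQ⟩ := EuclideanSpectrum.exists_isKPoint_near hK σ P hδ
    -- Approximation within the isolation radius forces equality.
    have hQP := hiso _ ⟨Q, rfl⟩ hPQ
    exact ⟨⟨Q, hKQ, hQP⟩, hQP ▸ hQ⟩
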